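/- Let $E$ be a countable set and let $M=(m_{ij})_{i,j\in E}$ be a real Metzler matrix ($m_{ij}\ge 0$ for $i\ne j$) that is irreducible: for all $i\neq j$ there are $i=i_0,i_1,\dots,i_m=j$ in $E$ with $m_{i_{l}i_{l+1}}>0$ for $0\le l<m$. Assume that the row sums $d_i=\sum_{k\in E}m_{ik}$ converge for all $i\in E$ and that $\sup_i m_{ii}<\infty$. Let $d\in\mathbb R$ be such that $M+dI$ is non-negative (for instance $d=\sup_i m_{ii}$, if $m_{ii}\ge -d$ for this $d$ and all $i$). Let $a^{(n)}_{ij}\in[0,\infty]$ be the entries of $(M+dI)^n$, and let $R_d=\sup\{r\ge 0:\sum_{n\ge0} r^n a^{(n)}_{ij}<\infty\}$ be its convergence parameter, which does not depend on $i,j$. Assume $R_d>0$ and let $\lambda=1/R_d-d\in\mathbb R$ (with $1/\infty=0$). Let $\bar M=(\bar m_{ij})$ be given by $\bar m_{ij}=m_{ij}/(\lambda-m_{ii})$ for $i\ne j$ and $\bar m_{ii}=0$, and assume that $\bar M$ is recurrent, i.e. $\sum_{n\ge0}\bar m^{(n)}_{ij}=\infty$ for all $i,j\in E$, where $\bar m^{(n)}_{ij}$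 are the entries of $\bar M^n$. Fix $j\in E$. Let $(X_t)_{t\ge0}$ be a minimal $Q$-process started at $j$ (killed at its explosion time) for the conservative $Q$-matrix $q_{ik}=m_{ik}-d_i\delta_{ik}$, and let $\mathbb E_j$ denote its expectation. Let $\xi_1=\inf\{t>0:X_t\ne X_0\}$ and $\sigma_j^+=\inf\{t\ge\xi_1:X_t=j\}$, with $\inf\emptyset=\infty$. Then $$u_i=\mathbb E_j\int_0^\infty \exp\Big(-\lambda t+\int_0^t d_{X_s}\,ds\Big)\,\mathbf 1_{\{X_t=i,\ t<\sigma_j^+\}}\,dt\in(0,\infty)\qquad(i\in E),$$ and $u=(u_i)_{i\in E}$ satisfies $uM=\lambda u$, i.e. $\sum_{k\in E}u_k m_{ki}=\lambda u_i$ for all $i\in E$. -/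

import Mathlib

open MeasureTheory
open scoped NNReal ENNReal

noncomputable section

namespace MetzlerRep

/-! Infinite matrices indexed by `E`. -/

/-- A Metzler matrix: the off-diagonal entries are non-negative. -/
def IsMetzler {E : Type*} (M : Matrix E E ℝ) : Prop :=
  ∀ i k, i ≠ k → 0 ≤ M i k

/-- Irreducibility: any two states `i ≠ k` are joined by a finite chain
`i = i₀, i₁, …, iₘ = k` along which all the entries of `M` are positive (a shortest such chain
has distinct states). -/
def IsIrreducible {E : Type*} (M : Matrix E E ℝ) : Prop :=
  ∀ i k, i ≠ k → Relation.TransGen (fun a b => 0 < M a b) i k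

/-- The row sums `d_i = ∑ₖ m_{ik}`. -/
def rowSum {E : Type*} (M : Matrix E E ℝ) (i : E) : ℝ :=
  ∑' k, M i k

/-- The entries `a_{ij}^{(n)}` of the powers `Aⁿ` of a non-negative matrix,
with values in `[0, ∞]`. -/
def npower {E : Type*} [DecidableEq E] (A : E → E → ℝ≥0∞) : ℕ → E → E → ℝ≥0∞
  | 0 => fun i j => if i = j then 1 else 0
  | n + 1 => fun i j => ∑' k, npower A n i k * A k j

/-- The convergence parameter `R ∈ [0, ∞]` of a non-negative matrix `A`: the supremum of the
`r ≥ 0` such that the series `∑ₙ rⁿ a_{ij}^{(n)}` converge. For an irreducible matrix the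
supremum for a single pair `(i, j)` does not depend on the pair, so that it is equal to `R`. -/
def convParam {E : Type*} [DecidableEq E] (A : E → E → ℝ≥0∞) : ℝ≥0∞ :=
  sSup ((fun r : ℝ≥0 => (r : ℝ≥0∞)) ''
    {r : ℝ≥0 | ∀ i j, ∑' n, (r : ℝ≥0∞) ^ n * npower A n i j < ∞})

/-- A non-negative matrix is recurrent if `∑ₙ a_{ij}^{(n)} = ∞`. -/
def IsRecurrent {E : Type*} [DecidableEq E] (A : E → E → ℝ≥0∞) : Prop :=
  ∀ i j, ∑' n, npower A n i j = ∞

/-- The matrix `M + d I`, with entries in `[0, ∞]`; it is only used when these entries are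
non-negative. -/
def shift {E : Type*} [DecidableEq E] (M : Matrix E E ℝ) (d : ℝ) : E → E → ℝ≥0∞ :=
  fun i k => ENNReal.ofReal ((M + d • (1 : Matrix E E ℝ)) i k)

/-- `λ = 1 / R_d - d`, with `R_d` the convergence parameter of `M + d I`
(`1 / ∞ = 0`; it is only used when `R_d > 0`). -/
def eigval {E : Type*} [DecidableEq E] (M : Matrix E E ℝ) (d : ℝ) : ℝ :=
  (convParam (shift M d))⁻¹.toReal - d

/-- The matrix with entries `m_{ik} / (lam - m_{ii})` off the diagonal and `0` on it. -/
def embedded {E : Type*} [DecidableEq E] (M : Matrix E E ℝ) (lam : ℝ) : Matrix E E ℝ :=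
  fun i k => if i = k then 0 else M i k / (lam - M i i)

/-- The conservative `Q`-matrix `q_{ik} = m_{ik} - d_i δ_{ik}`. -/
def qMatrix {E : Type*} [DecidableEq E] (M : Matrix E E ℝ) : Matrix E E ℝ :=
  fun i k => M i k - if i = k then rowSum M i else 0

/-! The minimal process of a conservative `Q`-matrix. -/

/-- The transition matrix of the jump chain of a conservative `Q`-matrix: `q_{ik} / q_i` for
`k ≠ i`, where `q_i = -q_{ii}`; a state with `q_i = 0` is absorbing. -/
def jumpMatrix {E : Type*} [DecidableEq E] (Q : Matrix E E ℝ) : Matrix E E ℝ :=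
  fun i k =>
    if Q i i = 0 then (if i = k then 1 else 0)
    else if i = k then 0 else Q i k / (-Q i i)

/-- `X` is, under `P`, a minimal `Q`-process started at `j`, in the sense of jump chain and
holding times: `Y` is a Markov chain started at `j` with the transition matrix `jumpMatrix Q`,
given `Y` the holding times `S 0, S 1, …` are independent, `S k` being exponential with the
parameter `q_{Y k}` (and infinite if this is `0`), and `X` is almost surely the path that
occupies `Y n` during `[S 0 + ⋯ + S (n - 1), S 0 + ⋯ + S n)` for all `n`. The value
`none` is the cemetery: the process is killed at the explosion time `S 0 + S 1 + ⋯`.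
Time is `t ≥ 0`; the values of `X` at negative times play no role. -/
def IsMinimalQProcess {E Ω : Type*} [DecidableEq E] [MeasurableSpace Ω]
    (Q : Matrix E E ℝ) (j : E) (P : Measure Ω) (X : ℝ → Ω → Option E) : Prop :=
  ∃ (Y : ℕ → Ω → E) (S : ℕ → Ω → ℝ≥0∞),
    (∀ n i, MeasurableSet {ω | Y n ω = i}) ∧
    (∀ n, Measurable (S n)) ∧
    (∀ (n : ℕ) (y : ℕ → E) (s : ℕ → ℝ≥0),
      P {ω | ∀ k ≤ n, Y k ω = y k ∧ (s k : ℝ≥0∞) < S k ω} =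
        ENNReal.ofReal ((if y 0 = j then 1 else 0) *
          (∏ k ∈ Finset.range n, jumpMatrix Q (y k) (y (k + 1))) *
          ∏ k ∈ Finset.range (n + 1), Real.exp (Q (y k) (y k) * s k))) ∧
    (∀ᵐ ω ∂P, ∀ t : ℝ, 0 ≤ t → ∀ i : E,
      X t ω = some i ↔
        ∃ n, (∑ k ∈ Finset.range n, S k ω) ≤ ENNReal.ofReal t ∧
          ENNReal.ofReal t < (∑ k ∈ Finset.range (n + 1), S k ω) ∧ Y n ω = i)

/-- The first jump time `ξ₁ = inf {t > 0 : x_t ≠ x_0}` of a path, with `inf ∅ = ∞`. -/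
def firstJump {E : Type*} (x : ℝ → Option E) : ℝ≥0∞ :=
  sInf (ENNReal.ofReal '' {t : ℝ | 0 < t ∧ x t ≠ x 0})

/-- The first return time `σ_j⁺ = inf {t ≥ ξ₁ : x_t = j}` of a path, with `inf ∅ = ∞`. -/
def returnTime {E : Type*} (j : E) (x : ℝ → Option E) : ℝ≥0∞ :=
  sInf (ENNReal.ofReal '' {t : ℝ | 0 ≤ t ∧ firstJump x ≤ ENNReal.ofReal t ∧ x t = some j})

/-- A real function `d` on the states, extended by `0` to the cemetery. -/
def extend {E : Type*} (d : E → ℝ) : Option E → ℝ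
  | none => 0
  | some i => d i

open Classical in
/-- `u_i = 𝔼 ∫₀^∞ exp (-lam t + ∫₀^t d_{X_s} ds) 1{X_t = i, t < σ_j⁺} dt ∈ [0, ∞]`. On
`{X_t = i}` no explosion has happened before `t`, so that `s ↦ d_{X_s}` is a step function with
finitely many steps on `[0, t]`. -/
def occupation {E Ω : Type*} [MeasurableSpace Ω] (d : E → ℝ) (lam : ℝ) (j : E)
    (P : Measure Ω) (X : ℝ → Ω → Option E) (i : E) : ℝ≥0∞ :=
  ∫⁻ ω, (∫⁻ t in Set.Ioi (0 : ℝ),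
    (if X t ω = some i ∧ ENNReal.ofReal t < returnTime j (fun s => X s ω) then
      ENNReal.ofReal (Real.exp (-lam * t + ∫ s in (0 : ℝ)..t, extend d (X s ω)))
    else 0)) ∂P

end MetzlerRep

end

namespace MetzlerRep

section Taboo

variable {E : Type*} [DecidableEq E]

/-- The total weight of the paths of length `n` from `j` to `i` which do not return to `j`. -/
noncomputable def taboo (A : E → E → ℝ≥0∞) (j : E) : ℕ → E → ℝ≥0∞
  | 0 => fun i => if i = j then 1 else 0
  | n + 1 => fun i => if i = j then 0 else ∑' k, taboo A j n k * A k i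

/-- The total weight of the paths from `j` to `i` which do not return to `j`. -/
noncomputable def tabooSum (A : E → E → ℝ≥0∞) (j i : E) : ℝ≥0∞ := ∑' n, taboo A j n i

/-- The total weight of the first return loops at `j`. -/
noncomputable def returnWeight (A : E → E → ℝ≥0∞) (j : E) : ℝ≥0∞ :=
  ∑' k, tabooSum A j k * A k j

lemma tabooSum_self (A : E → E → ℝ≥0∞) (j : E) : tabooSum A j j = 1 := by
  rw [tabooSum, tsum_eq_zero_add' ENNReal.summable]
  simp [taboo]

lemma tabooSum_of_ne (A : E → E → ℝ≥0∞) {i j : E} (h : i ≠ j) :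
    tabooSum A j i = ∑' k, tabooSum A j k * A k i := by
  rw [tabooSum, tsum_eq_zero_add' ENNReal.summable]
  simp only [taboo, h, if_false, zero_add, tabooSum, ← ENNReal.tsum_mul_right]
  exact ENNReal.tsum_comm

lemma sum_taboo_succ (A : E → E → ℝ≥0∞) {i j : E} (h : i ≠ j) (N : ℕ) :
    ∑ n ∈ Finset.range (N + 1), taboo A j n i =
      ∑' k, (∑ n ∈ Finset.range N, taboo A j n k) * A k i := by
  rw [Finset.sum_range_succ']
  simp only [taboo, h, if_false, add_zero, Finset.sum_mul]
  exact (Summable.tsum_finsetSum fun _ _ => ENNReal.summable).symm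

lemma mul_tabooSum_le (A : E → E → ℝ≥0∞) (j : E) (y : E → ℝ≥0∞)
    (hy : ∀ i, ∑' k, y k * A k i ≤ y i) (i : E) : y j * tabooSum A j i ≤ y i := by
  have key : ∀ N i, y j * ∑ n ∈ Finset.range N, taboo A j n i ≤ y i := by
    intro N
    induction N with
    | zero => simp
    | succ N ih =>
      intro i
      by_cases h : i = j
      · subst h
        rw [Finset.sum_range_succ']
        simp [taboo]
      · rw [sum_taboo_succ A h, ← ENNReal.tsum_mul_left]
        refine le_trans (ENNReal.tsum_le_tsum fun k => ?_) (hy i)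
        rw [← mul_assoc]
        gcongr
        exact ih k
  rw [tabooSum, ENNReal.tsum_eq_iSup_nat, ENNReal.mul_iSup]
  exact iSup_le fun N => key N i

lemma returnWeight_le_one (A : E → E → ℝ≥0∞) (j : E) (y : E → ℝ≥0∞)
    (hy : ∀ i, ∑' k, y k * A k i ≤ y i) (h0 : y j ≠ 0) (h1 : y j ≠ ∞) :
    returnWeight A j ≤ 1 := by
  have h : y j * returnWeight A j ≤ y j * 1 := by
    rw [mul_one, returnWeight, ← ENNReal.tsum_mul_left]
    refine le_trans (ENNReal.tsum_le_tsum fun k => ?_) (hy j)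
    rw [← mul_assoc]
    gcongr
    exact mul_tabooSum_le A j y hy k
  exact (ENNReal.mul_le_mul_iff_right h0 h1).1 h

lemma one_le_returnWeight (A : E → E → ℝ≥0∞) (j : E)
    (h : ∑' n, npower A n j j = ∞) : 1 ≤ returnWeight A j := by
  by_contra! hf
  set f := returnWeight A j with hfdef
  have hc0 : (1 - f) ≠ 0 := (tsub_pos_of_lt hf).ne'
  have hc1 : (1 - f) ≠ ∞ := ENNReal.sub_ne_top ENNReal.one_ne_top
  have hc : (1 - f)⁻¹ = 1 + f * (1 - f)⁻¹ := by
    calc (1 - f)⁻¹ = ((1 - f) + f) * (1 - f)⁻¹ := by rw [tsub_add_cancel_of_le hf.le, one_mul]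
      _ = _ := by rw [add_mul, ENNReal.mul_inv_cancel hc0 hc1]
  have key : ∀ N i, ∑ n ∈ Finset.range N, npower A n j i ≤ tabooSum A j i * (1 - f)⁻¹ := by
    intro N
    induction N with
    | zero => simp
    | succ N ih =>
      intro i
      have h1 : ∑ n ∈ Finset.range (N + 1), npower A n j i ≤
          (if j = i then 1 else 0) + (∑' k, tabooSum A j k * A k i) * (1 - f)⁻¹ := by
        rw [Finset.sum_range_succ', add_comm]
        simp only [npower]
        gcongr
        rw [← Summable.tsum_finsetSum fun _ _ => ENNReal.summable, ← ENNReal.tsum_mul_right]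
        refine ENNReal.tsum_le_tsum fun k => ?_
        rw [← Finset.sum_mul, mul_right_comm]
        gcongr
        exact ih k
      refine h1.trans ?_
      by_cases hij : i = j
      · subst hij
        rw [tabooSum_self, one_mul, if_pos rfl]
        exact hc.ge
      · rw [if_neg (Ne.symm hij), zero_add, ← tabooSum_of_ne A hij]
  have h2 : ∑' n, npower A n j j ≤ (1 - f)⁻¹ := by
    rw [ENNReal.tsum_eq_iSup_nat]
    refine iSup_le fun N => ?_
    simpa [tabooSum_self] using key N j
  rw [h, top_le_iff, ENNReal.inv_eq_top] at h2
  exact hc0 h2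

lemma taboo_mono {A B : E → E → ℝ≥0∞} (h : ∀ i k, A i k ≤ B i k) (j : E) (n : ℕ) (i : E) :
    taboo A j n i ≤ taboo B j n i := by
  induction n generalizing i with
  | zero => simp [taboo]
  | succ n ih =>
    simp only [taboo]
    split_ifs
    · exact le_rfl
    · exact ENNReal.tsum_le_tsum fun k => mul_le_mul' (ih k) (h k i)

lemma tsum_iSup_of_monotone {ι : Type*} [Countable ι] (g : ℕ → ι → ℝ≥0∞) (hg : Monotone g) :
    ∑' k, ⨆ m, g m k = ⨆ m, ∑' k, g m k := by
  let _ : MeasurableSpace ι := ⊤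
  simp only [← lintegral_count]
  exact lintegral_iSup (fun m => measurable_from_top) hg

lemma tsum_iSup_mul_iSup {ι : Type*} [Countable ι] (a b : ℕ → ι → ℝ≥0∞) (ha : Monotone a) (hb : Monotone b) :
    ∑' k, (⨆ m, a m k) * (⨆ m, b m k) = ⨆ m, ∑' k, a m k * b m k := by
  rw [← tsum_iSup_of_monotone (fun m k => a m k * b m k)
    (fun m n h k => mul_le_mul' (ha h k) (hb h k))]
  congr 1
  ext k
  refine le_antisymm ?_ ENNReal.iSup_mul_le
  simp only [ENNReal.iSup_mul, ENNReal.mul_iSup]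
  exact iSup_le fun m => iSup_le fun n => le_iSup_of_le (max m n)
    (mul_le_mul' (ha (le_max_right m n) k) (hb (le_max_left m n) k))

lemma taboo_iSup [Countable E] (A : ℕ → E → E → ℝ≥0∞) (hA : Monotone A) (j : E) (n : ℕ) (i : E) :
    taboo (fun i k => ⨆ m, A m i k) j n i = ⨆ m, taboo (A m) j n i := by
  induction n generalizing i with
  | zero => simp [taboo]
  | succ n ih =>
    simp only [taboo]
    split_ifs
    · simp
    · simp only [ih]
      exact tsum_iSup_mul_iSup (fun m k => taboo (A m) j n k) (fun m k => A m k i)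
        (fun m m' h k => taboo_mono (hA h) j n k) (fun m m' h k => hA h k i)

lemma returnWeight_iSup [Countable E] (A : ℕ → E → E → ℝ≥0∞) (hA : Monotone A) (j : E) :
    returnWeight (fun i k => ⨆ m, A m i k) j = ⨆ m, returnWeight (A m) j := by
  have h : ∀ i, tabooSum (fun i k => ⨆ m, A m i k) j i = ⨆ m, tabooSum (A m) j i := by
    intro i
    simp only [tabooSum, taboo_iSup A hA]
    exact tsum_iSup_of_monotone (fun m n => taboo (A m) j n i)
      (fun m m' hm n => taboo_mono (hA hm) j n i)
  simp only [returnWeight, h]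
  exact tsum_iSup_mul_iSup (fun m k => tabooSum (A m) j k) (fun m k => A m k j)
    (fun m m' h k => ENNReal.tsum_le_tsum fun n => taboo_mono (hA h) j n k)
    (fun m m' h k => hA h k j)

lemma exists_ne_zero_of_recurrent {A : E → E → ℝ≥0∞} (h : IsRecurrent A) (i : E) :
    ∃ k, A i k ≠ 0 := by
  by_contra! h0
  have h1 : ∀ n k, npower A (n + 1) i k = 0 := by
    intro n
    induction n with
    | zero => simp [npower, h0]
    | succ n ih =>
      intro k
      rw [npower]
      simp [ih]
  have h2 := h i i
  rw [tsum_eq_zero_add' ENNReal.summable] at h2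
  simp only [h1, tsum_zero, add_zero] at h2
  simp [npower] at h2

/-- The invariance of `tabooSum` for a recurrent matrix with convergence parameter one. -/
lemma tabooSum_invariant {A : E → E → ℝ≥0∞} {j : E} (h : returnWeight A j = 1) (i : E) :
    ∑' k, tabooSum A j k * A k i = tabooSum A j i := by
  by_cases hij : i = j
  · subst hij
    rw [tabooSum_self, ← h, returnWeight]
  · rw [tabooSum_of_ne A hij]

end Taboo

section Eigenvalue

variable {E : Type*} [DecidableEq E]

/-- The matrix `embedded M lam` with entries in `[0, ∞]`. -/
noncomputable def embeddedENN (M : Matrix E E ℝ) (lam : ℝ) : E → E → ℝ≥0∞ :=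
  fun i k => ENNReal.ofReal (embedded M lam i k)

lemma exists_pos_of_recurrent_embedded {M : Matrix E E ℝ} (hM : IsMetzler M) {lam : ℝ}
    (hrec : IsRecurrent (embeddedENN M lam)) (i : E) :
    M i i < lam ∧ ∃ k, k ≠ i ∧ 0 < M i k := by
  obtain ⟨k, hk⟩ := exists_ne_zero_of_recurrent hrec i
  have hpos : 0 < embedded M lam i k := by
    by_contra! h
    exact hk (ENNReal.ofReal_of_nonpos h)
  unfold embedded at hpos
  split_ifs at hpos with h
  · exact absurd hpos (lt_irrefl _)
  · rcases div_pos_iff.1 hpos with h1 | h1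
    · exact ⟨by linarith [h1.2], k, Ne.symm h, h1.1⟩
    · exact absurd (hM i k h) (not_le.2 h1.1)

lemma ofReal_mul_embeddedENN {M : Matrix E E ℝ} {lam : ℝ} {k : E} (hk : M k k < lam) (i : E) :
    ENNReal.ofReal (lam - M k k) * embeddedENN M lam k i =
      if k = i then 0 else ENNReal.ofReal (M k i) := by
  unfold embeddedENN embedded
  split_ifs with h
  · simp
  · rw [← ENNReal.ofReal_mul (sub_pos.2 hk).le, mul_div_cancel₀ _ (sub_pos.2 hk).ne']

lemma embeddedENN_anti {M : Matrix E E ℝ} (hM : IsMetzler M) {lam lam' : ℝ} (h : lam ≤ lam')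
    (hlam : ∀ i, M i i < lam) (i k : E) : embeddedENN M lam' i k ≤ embeddedENN M lam i k := by
  unfold embeddedENN embedded
  split_ifs with hik
  · exact le_rfl
  · apply ENNReal.ofReal_le_ofReal
    have := hlam i
    have h2 := hM i k hik
    have h3 : 0 < lam - M i i := by linarith
    gcongr

lemma inv_lt_convParam {M : Matrix E E ℝ} {d lam : ℝ} (hR : 0 < convParam (shift M d))
    (h : eigval M d < lam) : (ENNReal.ofReal (lam + d))⁻¹ < convParam (shift M d) := by
  rw [ENNReal.inv_lt_iff_inv_lt]
  refine (ENNReal.lt_ofReal_iff_toReal_lt (ENNReal.inv_ne_top.2 hR.ne')).2 ?_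
  unfold eigval at h
  linarith

lemma eigval_add_nonneg (M : Matrix E E ℝ) (d : ℝ) : 0 ≤ eigval M d + d := by
  simp [eigval]

lemma tsum_npower_lt_top {A : E → E → ℝ≥0∞} {r : ℝ≥0∞} (h : r < convParam A) (i j : E) :
    ∑' n, r ^ n * npower A n i j < ∞ := by
  obtain ⟨_, ⟨s, hs, rfl⟩, hrs⟩ := lt_sSup_iff.1 h
  refine lt_of_le_of_lt (ENNReal.tsum_le_tsum fun n => ?_) (hs i j)
  have := hrs.le
  gcongr

/-- The Green function `∑ rⁿ Aⁿ` satisfies `G = I + G r A`. -/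
lemma green_eq (A : E → E → ℝ≥0∞) (r : ℝ≥0∞) (j i : E) :
    ∑' n, r ^ n * npower A n j i = (if j = i then 1 else 0) +
      r * ∑' k, (∑' n, r ^ n * npower A n j k) * A k i := by
  rw [tsum_eq_zero_add' ENNReal.summable]
  congr 1
  · simp [npower]
  · simp only [npower, ← ENNReal.tsum_mul_left, ← ENNReal.tsum_mul_right]
    rw [ENNReal.tsum_comm]
    refine tsum_congr fun k => tsum_congr fun n => ?_
    ring

lemma shift_apply_self (M : Matrix E E ℝ) (d : ℝ) (i : E) :
    shift M d i i = ENNReal.ofReal (M i i + d) := by simp [shift]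

lemma shift_apply_of_ne (M : Matrix E E ℝ) (d : ℝ) {i k : E} (h : i ≠ k) :
    shift M d i k = ENNReal.ofReal (M i k) := by simp [shift, h]

lemma returnWeight_embedded_le_one_of_lt {M : Matrix E E ℝ} {d : ℝ}
    (hd : ∀ i, 0 ≤ M i i + d) (hR : 0 < convParam (shift M d)) {lam : ℝ}
    (h : eigval M d < lam) (hlam : ∀ i, M i i < lam) (j : E) :
    returnWeight (embeddedENN M lam) j ≤ 1 := by
  have hpos : 0 < lam + d := by linarith [eigval_add_nonneg M d]
  set s := ENNReal.ofReal (lam + d) with hs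
  have hs0 : s ≠ 0 := by simpa [hs] using hpos
  have hs1 : s ≠ ∞ := ENNReal.ofReal_ne_top
  set G : E → ℝ≥0∞ := fun i => ∑' n, s⁻¹ ^ n * npower (shift M d) n j i with hG
  have hGtop : ∀ i, G i ≠ ∞ := fun i => (tsum_npower_lt_top (inv_lt_convParam hR h) j i).ne
  have hGeq : ∀ i, G i = (if j = i then 1 else 0) + s⁻¹ * ∑' k, G k * shift M d k i :=
    fun i => green_eq _ _ j i
  have hle : ∀ i, ∑' k, G k * shift M d k i ≤ s * G i := by
    intro i
    rw [hGeq i, mul_add, ← mul_assoc, ENNReal.mul_inv_cancel hs0 hs1, one_mul]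
    exact le_add_self
  refine returnWeight_le_one _ j (fun i => G i * ENNReal.ofReal (lam - M i i)) (fun i => ?_) ?_ ?_
  · simp only [mul_assoc, ofReal_mul_embeddedENN (hlam _)]
    have h1 : ∑' k, G k * shift M d k i =
        G i * ENNReal.ofReal (M i i + d) +
          ∑' k, G k * (if k = i then 0 else ENNReal.ofReal (M k i)) := by
      rw [ENNReal.tsum_eq_add_tsum_ite i, shift_apply_self]
      congr 1
      refine tsum_congr fun k => ?_
      split_ifs with hk
      · simp
      · rw [shift_apply_of_ne M d hk]
    have h2 := hle i
    have h3 : s * G i = G i * ENNReal.ofReal (M i i + d) + G i * ENNReal.ofReal (lam - M i i) := by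
      rw [← mul_add, ← ENNReal.ofReal_add (hd i) (sub_pos.2 (hlam i)).le, mul_comm, hs]
      congr 2
      ring
    rw [h1, h3] at h2
    exact (ENNReal.add_le_add_iff_left (ENNReal.mul_ne_top (hGtop i) ENNReal.ofReal_ne_top)).1 h2
  · refine mul_ne_zero ?_ (by simpa using hlam j)
    rw [hGeq j]
    simp
  · exact ENNReal.mul_ne_top (hGtop j) ENNReal.ofReal_ne_top

lemma returnWeight_embedded_le_one [Countable E] {M : Matrix E E ℝ} (hM : IsMetzler M) {d : ℝ}
    (hd : ∀ i, 0 ≤ M i i + d) (hR : 0 < convParam (shift M d))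
    (hlam : ∀ i, M i i < eigval M d) (j : E) :
    returnWeight (embeddedENN M (eigval M d)) j ≤ 1 := by
  set lam := eigval M d with hl
  set l : ℕ → ℝ := fun n => lam + 1 / ((n : ℝ) + 1) with hldef
  have hlt : ∀ n, lam < l n := fun n => by simp only [hldef]; linarith [@Nat.one_div_pos_of_nat ℝ _ _ _ n]
  have hanti : Antitone l := fun m n h => by
    simp only [hldef]
    have := @Nat.one_div_le_one_div ℝ _ _ _ m n h
    linarith
  have hmono : Monotone fun n => embeddedENN M (l n) := fun m n h i k =>
    embeddedENN_anti hM (hanti h) (fun i => (hlam i).trans (hlt n)) i k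
  have hsup : embeddedENN M lam = fun i k => ⨆ n, embeddedENN M (l n) i k := by
    ext i k
    refine (iSup_eq_of_tendsto (fun m n h => hmono h i k) ?_).symm
    by_cases hik : i = k
    · simp [embeddedENN, embedded, hik]
    · simp only [embeddedENN, embedded, hik, if_false]
      refine ENNReal.tendsto_ofReal ?_
      have h1 : Filter.Tendsto l Filter.atTop (nhds lam) := by
        have := (tendsto_const_nhds (x := lam)).add
          (tendsto_one_div_add_atTop_nhds_zero_nat (𝕜 := ℝ))
        rwa [add_zero] at this
      exact (tendsto_const_nhds (x := M i k)).div (h1.sub tendsto_const_nhds)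
        (sub_pos.2 (hlam i)).ne'
  rw [hsup, returnWeight_iSup _ hmono]
  exact iSup_le fun n => returnWeight_embedded_le_one_of_lt hd hR (hlt n)
    (fun i => (hlam i).trans (hlt n)) j

lemma tabooSum_pos_and_lt_top {M : Matrix E E ℝ} (hirr : IsIrreducible M) {lam : ℝ}
    (hlam : ∀ i, M i i < lam) {j : E} (h : returnWeight (embeddedENN M lam) j = 1) (i : E) :
    0 < tabooSum (embeddedENN M lam) j i ∧ tabooSum (embeddedENN M lam) j i < ∞ := by
  set v := tabooSum (embeddedENN M lam) j with hv
  have hstep : ∀ a b, v a * embeddedENN M lam a b ≤ v b := fun a b => by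
    rw [hv, ← tabooSum_invariant h b]
    exact ENNReal.le_tsum (f := fun a => tabooSum (embeddedENN M lam) j a * _) a
  have hent : ∀ a b, a ≠ b → 0 < M a b → 0 < embeddedENN M lam a b := fun a b hab hpos => by
    simp only [embeddedENN, embedded, hab, if_false, ENNReal.ofReal_pos]
    exact div_pos hpos (sub_pos.2 (hlam a))
  have hvj : v j = 1 := tabooSum_self _ j
  have hup : ∀ a b, Relation.TransGen (fun a b => 0 < M a b) a b → 0 < v a → 0 < v b := by
    intro a b hab ha
    have one : ∀ a b, 0 < M a b → 0 < v a → 0 < v b := fun a b hab ha => by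
      by_cases he : a = b
      · exact he ▸ ha
      · exact lt_of_lt_of_le (ENNReal.mul_pos ha.ne' (hent a b he hab).ne') (hstep a b)
    induction hab with
    | single h => exact one _ _ h ha
    | tail _ h ih => exact one _ _ h ih
  have hdown : ∀ a b, Relation.TransGen (fun a b => 0 < M a b) a b → v b < ∞ → v a < ∞ := by
    intro a b hab
    have one : ∀ a b, 0 < M a b → v b < ∞ → v a < ∞ := fun a b hab hb => by
      by_cases he : a = b
      · exact he ▸ hb
      · by_contra! ha
        have h2 := hstep a b
        rw [top_le_iff.1 ha, ENNReal.top_mul (hent a b he hab).ne', top_le_iff] at h2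
        exact hb.ne h2
    induction hab with
    | single h => exact one _ _ h
    | tail _ h ih => exact fun hb => ih (one _ _ h hb)
  by_cases hij : i = j
  · subst hij
    simp [hvj]
  · exact ⟨hup j i (hirr j i (Ne.symm hij)) (by simp [hvj]),
      hdown i j (hirr i j hij) (by simp [hvj])⟩

end Eigenvalue

section ExponentialLaw

lemma lintegral_exp_neg_mul_Ioi {a : ℝ} (ha : 0 < a) (s : ℝ) :
    ∫⁻ x in Set.Ioi s, ENNReal.ofReal (Real.exp (-a * x)) =
      ENNReal.ofReal (Real.exp (-a * s) / a) := by
  rw [← ofReal_integral_eq_lintegral_ofReal (integrableOn_exp_mul_Ioi (by linarith) s)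
    (Filter.Eventually.of_forall fun x => (Real.exp_pos _).le),
    integral_exp_mul_Ioi (by linarith)]
  congr 1
  rw [neg_div_neg_eq]

/-- The exponential law with parameter `q`, as a measure on `[0, ∞]`. -/
noncomputable def expLaw (q : ℝ) : Measure ℝ≥0∞ :=
  ((volume.restrict (Set.Ioi 0)).withDensity
    fun x => ENNReal.ofReal q * ENNReal.ofReal (Real.exp (-q * x))).map ENNReal.ofReal

lemma lintegral_expLaw (q : ℝ) {g : ℝ≥0∞ → ℝ≥0∞} (hg : Measurable g) :
    ∫⁻ s, g s ∂expLaw q = ENNReal.ofReal q *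
      ∫⁻ x in Set.Ioi (0 : ℝ), ENNReal.ofReal (Real.exp (-q * x)) * g (ENNReal.ofReal x) := by
  rw [expLaw, lintegral_map hg ENNReal.measurable_ofReal,
    lintegral_withDensity_eq_lintegral_mul _ (by fun_prop)
      (g := fun x => g (ENNReal.ofReal x)) (by fun_prop), ← lintegral_const_mul _ (by fun_prop)]
  simp only [Pi.mul_apply, mul_assoc]

lemma expLaw_Ioi {q : ℝ} (hq : 0 < q) (s : ℝ≥0) :
    expLaw q (Set.Ioi (s : ℝ≥0∞)) = ENNReal.ofReal (Real.exp (-q * s)) := by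
  rw [← lintegral_indicator_one measurableSet_Ioi, lintegral_expLaw _
    (measurable_one.indicator measurableSet_Ioi)]
  have h : ∀ x : ℝ, ENNReal.ofReal (Real.exp (-q * x)) *
      (Set.Ioi (s : ℝ≥0∞)).indicator 1 (ENNReal.ofReal x) =
      (Set.Ioi (s : ℝ)).indicator (fun x => ENNReal.ofReal (Real.exp (-q * x))) x := by
    intro x
    have hx : ENNReal.ofReal x ∈ Set.Ioi (s : ℝ≥0∞) ↔ x ∈ Set.Ioi (s : ℝ) := by
      rw [Set.mem_Ioi, Set.mem_Ioi, ← ENNReal.ofReal_coe_nnreal,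
        ENNReal.ofReal_lt_ofReal_iff_of_nonneg (NNReal.coe_nonneg s)]
    by_cases hxs : x ∈ Set.Ioi (s : ℝ)
    · rw [Set.indicator_of_mem hxs, Set.indicator_of_mem (hx.2 hxs)]; simp
    · rw [Set.indicator_of_notMem hxs, Set.indicator_of_notMem (fun h => hxs (hx.1 h))]; simp
  simp only [h]
  rw [setLIntegral_indicator measurableSet_Ioi,
    Set.inter_eq_left.2 (Set.Ioi_subset_Ioi (NNReal.coe_nonneg s)), lintegral_exp_neg_mul_Ioi hq,
    ← ENNReal.ofReal_mul hq.le, mul_div_cancel₀ _ hq.ne']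

lemma expLaw_univ {q : ℝ} (hq : 0 < q) : expLaw q Set.univ = 1 := by
  rw [← lintegral_one, lintegral_expLaw _ measurable_const]
  simp only [mul_one]
  rw [lintegral_exp_neg_mul_Ioi hq, ← ENNReal.ofReal_mul hq.le, mul_div_cancel₀ _ hq.ne']
  simp

lemma isProbabilityMeasure_expLaw {q : ℝ} (hq : 0 < q) : IsProbabilityMeasure (expLaw q) :=
  ⟨expLaw_univ hq⟩

lemma expLaw_singleton_top (q : ℝ) : expLaw q {∞} = 0 := by
  rw [← lintegral_indicator_one (measurableSet_singleton _), lintegral_expLaw _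
    (measurable_one.indicator (measurableSet_singleton _))]
  simp

/-- The weight that a holding time `s` contributes at exponential rate `a`. -/
noncomputable def expWeight (a : ℝ) (s : ℝ≥0∞) : ℝ≥0∞ := ENNReal.ofReal (Real.exp (a * s.toReal))

/-- The integral of `exp (a t)` over `0 < t < s`. -/
noncomputable def expOccupation (a : ℝ) (s : ℝ≥0∞) : ℝ≥0∞ :=
  ∫⁻ t in Set.Ioi (0 : ℝ),
    if ENNReal.ofReal t < s then ENNReal.ofReal (Real.exp (a * t)) else 0

lemma measurable_expWeight (a : ℝ) : Measurable (expWeight a) := by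
  unfold expWeight
  fun_prop

lemma measurable_expOccupation_uncurry (a : ℝ) :
    Measurable fun p : ℝ≥0∞ × ℝ =>
      if ENNReal.ofReal p.2 < p.1 then ENNReal.ofReal (Real.exp (a * p.2)) else 0 :=
  Measurable.ite (measurableSet_lt (by fun_prop) (by fun_prop)) (by fun_prop) measurable_const

lemma measurable_expOccupation (a : ℝ) : Measurable (expOccupation a) :=
  (measurable_expOccupation_uncurry a).lintegral_prod_right'

lemma lintegral_expWeight {q a : ℝ} (hq : 0 < q) (ha : a < q) :
    ∫⁻ s, expWeight a s ∂expLaw q = ENNReal.ofReal (q / (q - a)) := by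
  rw [lintegral_expLaw _ (measurable_expWeight a)]
  have h : ∀ x ∈ Set.Ioi (0 : ℝ), ENNReal.ofReal (Real.exp (-q * x)) *
      expWeight a (ENNReal.ofReal x) = ENNReal.ofReal (Real.exp (-(q - a) * x)) := by
    intro x hx
    rw [expWeight, ← ENNReal.ofReal_mul (Real.exp_pos _).le, ← Real.exp_add,
      ENNReal.toReal_ofReal (le_of_lt hx)]
    congr 2
    ring
  rw [setLIntegral_congr_fun measurableSet_Ioi h, lintegral_exp_neg_mul_Ioi (sub_pos.2 ha),
    ← ENNReal.ofReal_mul hq.le]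
  simp [div_eq_mul_inv]

lemma lintegral_expOccupation {q a : ℝ} (hq : 0 < q) (ha : a < q) :
    ∫⁻ s, expOccupation a s ∂expLaw q = ENNReal.ofReal (1 / (q - a)) := by
  have := isProbabilityMeasure_expLaw hq
  unfold expOccupation
  rw [lintegral_lintegral_swap (measurable_expOccupation_uncurry a).aemeasurable]
  have h : ∀ x ∈ Set.Ioi (0 : ℝ), ∫⁻ s, (if ENNReal.ofReal x < s then
      ENNReal.ofReal (Real.exp (a * x)) else 0) ∂expLaw q =
      ENNReal.ofReal (Real.exp (-(q - a) * x)) := by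
    intro x hx
    have h1 : (fun s : ℝ≥0∞ => if ENNReal.ofReal x < s then
        ENNReal.ofReal (Real.exp (a * x)) else 0) =
        (Set.Ioi (ENNReal.ofReal x)).indicator fun _ => ENNReal.ofReal (Real.exp (a * x)) := by
      ext s
      simp [Set.indicator]
    have h2 : expLaw q (Set.Ioi (ENNReal.ofReal x)) = ENNReal.ofReal (Real.exp (-q * x)) := by
      have := expLaw_Ioi hq x.toNNReal
      rwa [Real.coe_toNNReal x (le_of_lt hx)] at this
    rw [h1, lintegral_indicator_const measurableSet_Ioi, h2, ← ENNReal.ofReal_mul (Real.exp_pos _).le, ← Real.exp_add]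
    congr 2
    ring
  rw [setLIntegral_congr_fun measurableSet_Ioi h, lintegral_exp_neg_mul_Ioi (sub_pos.2 ha)]
  simp

end ExponentialLaw

section Paths

variable {E : Type*} [DecidableEq E]

/-- The product of the entries of `J` along a path started at `j`. -/
noncomputable def pathWeight (J : E → E → ℝ≥0∞) (j : E) {n : ℕ} (y : Fin (n + 1) → E) : ℝ≥0∞ :=
  (if y 0 = j then 1 else 0) * ∏ k : Fin n, J (y k.castSucc) (y k.succ)

lemma tsum_path_succ {ι : Type*} {n : ℕ} (F : (Fin (n + 1) → ι) → ℝ≥0∞) :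
    ∑' y, F y = ∑' y : Fin n → ι, ∑' k, F (Fin.snoc y k) := by
  rw [ENNReal.tsum_comm, ← ENNReal.tsum_prod,
    ← (Fin.snocEquiv fun _ : Fin (n + 1) => ι).tsum_eq]
  rfl

lemma tsum_path_zero {ι : Type*} (F : (Fin 1 → ι) → ℝ≥0∞) :
    ∑' y, F y = ∑' k, F (fun _ => k) := by
  rw [← (Equiv.funUnique (Fin 1) ι).symm.tsum_eq]
  rfl

lemma pathWeight_snoc (J : E → E → ℝ≥0∞) (j : E) {n : ℕ} (y : Fin (n + 1) → E) (k : E) :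
    pathWeight J j (Fin.snoc y k : Fin (n + 2) → E) =
      pathWeight J j y * J (y (Fin.last n)) k := by
  have h0 : (Fin.snoc y k : Fin (n + 2) → E) 0 = y 0 := by
    rw [← Fin.castSucc_zero, Fin.snoc_castSucc]
  rw [pathWeight, pathWeight, Fin.prod_univ_castSucc, h0, mul_assoc]
  simp only [Fin.snoc_castSucc, Fin.succ_last, Fin.snoc_last, ← Fin.castSucc_succ]

lemma tsum_pathWeight (J : E → E → ℝ≥0∞) (hJ : ∀ i, ∑' k, J i k = 1) (j : E) (n : ℕ) :
    ∑' y : Fin (n + 1) → E, pathWeight J j y = 1 := by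
  induction n with
  | zero =>
    rw [tsum_path_zero]
    simp [pathWeight]
  | succ n ih =>
    rw [tsum_path_succ]
    simp only [pathWeight_snoc, ENNReal.tsum_mul_left, hJ, mul_one, ih]

lemma pathWeight_ne_top (J : E → E → ℝ≥0∞) (hJ : ∀ i, ∑' k, J i k = 1) (j : E) {n : ℕ}
    (y : Fin (n + 1) → E) : pathWeight J j y ≠ ∞ := by
  refine ((ENNReal.le_tsum y).trans_lt ?_).ne
  rw [tsum_pathWeight J hJ]
  exact ENNReal.one_lt_top

lemma tsum_pathWeight_taboo (A : E → E → ℝ≥0∞) (j i : E) (n : ℕ) :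
    ∑' y : Fin (n + 1) → E,
      (if y (Fin.last n) = i ∧ ∀ k, k ≠ 0 → y k ≠ j then pathWeight A j y else 0) =
      taboo A j n i := by
  induction n generalizing i with
  | zero =>
    rw [tsum_path_zero, tsum_eq_single i]
    · simp [pathWeight, taboo, Fin.forall_fin_one]
    · intro k hk
      simp [hk]
  | succ n ih =>
    have hiff : ∀ (y : Fin (n + 1) → E) (k : E),
        ((Fin.snoc y k : Fin (n + 2) → E) (Fin.last (n + 1)) = i ∧
          ∀ m, m ≠ 0 → (Fin.snoc y k : Fin (n + 2) → E) m ≠ j) ↔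
        k = i ∧ i ≠ j ∧ ∀ m, m ≠ 0 → y m ≠ j := by
      intro y k
      rw [Fin.forall_fin_succ']
      simp only [Fin.snoc_last, Fin.snoc_castSucc, ne_eq, Fin.castSucc_eq_zero_iff]
      constructor
      · rintro ⟨rfl, h1, h2⟩
        exact ⟨rfl, h2 (by simp [Fin.ext_iff]), h1⟩
      · rintro ⟨rfl, h1, h2⟩
        exact ⟨rfl, h2, fun _ => h1⟩
    rw [tsum_path_succ]
    simp only [hiff, pathWeight_snoc, taboo]
    split_ifs with hij
    · simp [hij]
    · have h1 : ∀ y : Fin (n + 1) → E,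
          ∑' k, (if k = i ∧ i ≠ j ∧ ∀ m, m ≠ 0 → y m ≠ j then
            pathWeight A j y * A (y (Fin.last n)) k else 0) =
          ∑' k, (if y (Fin.last n) = k ∧ ∀ m, m ≠ 0 → y m ≠ j then
            pathWeight A j y else 0) * A k i := by
        intro y
        rw [tsum_eq_single i, tsum_eq_single (y (Fin.last n))]
        · simp [hij]
        · intro k hk
          simp [Ne.symm hk]
        · intro k hk
          simp [hk]
      simp only [h1]
      rw [ENNReal.tsum_comm]
      simp only [ENNReal.tsum_mul_right, ih]

end Paths

section JumpHold

variable {E Ω : Type*} [DecidableEq E] [MeasurableSpace Ω]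

/-- `Y` is a Markov chain started at `j` with the transition matrix `J`, and given `Y` the holding
times `S k` are independent and exponential with the parameters `q (Y k)`. -/
structure IsJumpHold (q : E → ℝ) (J : E → E → ℝ≥0∞) (j : E) (P : Measure Ω)
    (Y : ℕ → Ω → E) (S : ℕ → Ω → ℝ≥0∞) : Prop where
  rate_pos : ∀ i, 0 < q i
  stochastic : ∀ i, ∑' k, J i k = 1
  measurableSet_jump : ∀ n i, MeasurableSet {ω | Y n ω = i}
  measurable_hold : ∀ n, Measurable (S n)
  law : ∀ (n : ℕ) (y : Fin (n + 1) → E) (s : Fin (n + 1) → ℝ≥0),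
    P {ω | ∀ k : Fin (n + 1), Y k ω = y k ∧ (s k : ℝ≥0∞) < S k ω} =
      pathWeight J j y * ∏ k, ENNReal.ofReal (Real.exp (-q (y k) * s k))

namespace IsJumpHold

variable {q : E → ℝ} {J : E → E → ℝ≥0∞} {j : E} {P : Measure Ω}
  {Y : ℕ → Ω → E} {S : ℕ → Ω → ℝ≥0∞}

lemma measurableSet_path (h : IsJumpHold q J j P Y S) {n : ℕ} (y : Fin (n + 1) → E) :
    MeasurableSet {ω | ∀ k : Fin (n + 1), Y k ω = y k} :=
  measurableSet_setOfPred.2 (Measurable.forall fun k => measurableSet_setOfPred.1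
    (h.measurableSet_jump k (y k)))

lemma ae_hold_pos [Countable E] [IsProbabilityMeasure P] (h : IsJumpHold q J j P Y S) :
    ∀ᵐ ω ∂P, ∀ k, 0 < S k ω := by
  rw [ae_all_iff]
  intro n
  have hU : {ω | ∀ k : Fin (n + 1), 0 < S k ω} =
      ⋃ y : Fin (n + 1) → E, {ω | ∀ k : Fin (n + 1), Y k ω = y k ∧ ((0 : ℝ≥0) : ℝ≥0∞) < S k ω} := by
    ext ω
    simp only [Set.mem_ofPred_eq, Set.mem_iUnion, ENNReal.coe_zero]
    exact ⟨fun hω => ⟨fun k => Y k ω, fun k => ⟨rfl, hω k⟩⟩, fun ⟨y, hy⟩ k => (hy k).2⟩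
  have hm : ∀ y : Fin (n + 1) → E, MeasurableSet
      {ω | ∀ k : Fin (n + 1), Y k ω = y k ∧ ((0 : ℝ≥0) : ℝ≥0∞) < S k ω} := fun y => by
    simp only [forall_and]
    exact (h.measurableSet_path y).inter (measurableSet_setOfPred.2 (Measurable.forall fun k =>
      measurableSet_setOfPred.1 (measurableSet_lt measurable_const (h.measurable_hold k))))
  have hP : P {ω | ∀ k : Fin (n + 1), 0 < S k ω} = 1 := by
    rw [hU, measure_iUnion _ hm]
    · rw [← tsum_pathWeight J h.stochastic j n]
      refine tsum_congr fun y => ?_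
      rw [h.law n y fun _ => 0]
      simp
    · intro y y' hy
      refine Set.disjoint_left.2 fun ω h1 h2 => hy (funext fun k => ?_)
      exact (h1 k).1.symm.trans (h2 k).1
  have hae : ∀ᵐ ω ∂P, ∀ k : Fin (n + 1), 0 < S k ω := by
    rw [← prob_compl_eq_zero_iff (hU ▸ MeasurableSet.iUnion hm)] at hP
    exact hP
  filter_upwards [hae] with ω hω
  exact hω (Fin.last n)

/-- The half-lines `(s, ∞]` with finite `s`, and the whole space. -/
def halfLines : Set (Set ℝ≥0∞) := insert Set.univ (Set.range fun s : ℝ≥0 => Set.Ioi (s : ℝ≥0∞))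

lemma isPiSystem_halfLines : IsPiSystem halfLines := by
  refine IsPiSystem.insert_univ ?_
  have := isPiSystem_image_Ioi (Set.range fun s : ℝ≥0 => (s : ℝ≥0∞))
  rwa [← Set.range_comp] at this

lemma generateFrom_halfLines :
    MeasurableSpace.generateFrom halfLines = (inferInstance : MeasurableSpace ℝ≥0∞) := by
  rw [halfLines, MeasurableSpace.generateFrom_insert_univ]
  rw [BorelSpace.measurable_eq (α := ℝ≥0∞), borel_eq_generateFrom_Ioi]
  refine le_antisymm (MeasurableSpace.generateFrom_mono ?_) (MeasurableSpace.generateFrom_le ?_)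
  · rintro _ ⟨s, rfl⟩
    exact ⟨_, rfl⟩
  · rintro _ ⟨s, rfl⟩
    induction s using ENNReal.recTopCoe with
    | top => simp
    | coe s => exact MeasurableSpace.measurableSet_generateFrom ⟨s, rfl⟩

lemma map_hold [Countable E] [IsProbabilityMeasure P] (h : IsJumpHold q J j P Y S)
    {n : ℕ} (y : Fin (n + 1) → E) :
    (P.restrict {ω | ∀ k : Fin (n + 1), Y k ω = y k}).map (fun ω (k : Fin (n + 1)) => S k ω) =
      pathWeight J j y • Measure.pi fun k => expLaw (q (y k)) := by
  have hpr : ∀ k, IsProbabilityMeasure (expLaw (q (y k))) := fun k =>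
    isProbabilityMeasure_expLaw (h.rate_pos _)
  have hSm : Measurable (fun ω (k : Fin (n + 1)) => S k ω) :=
    measurable_pi_lambda _ fun k => h.measurable_hold k
  set ν := (P.restrict {ω | ∀ k : Fin (n + 1), Y k ω = y k}).map
    (fun ω (k : Fin (n + 1)) => S k ω) with hν
  have hbox : ∀ s : Fin (n + 1) → Set ℝ≥0∞, (∀ k, s k ∈ halfLines) →
      ν (Set.univ.pi s) = pathWeight J j y * ∏ k, expLaw (q (y k)) (s k) := by
    intro s hs
    have hex : ∀ k, ∃ r : ℝ≥0, (∀ x : ℝ≥0∞, 0 < x → (x ∈ s k ↔ (r : ℝ≥0∞) < x)) ∧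
        expLaw (q (y k)) (s k) = ENNReal.ofReal (Real.exp (-q (y k) * r)) := by
      intro k
      rcases hs k with hk | ⟨r, hk⟩
      · refine ⟨0, fun x hx => ?_, ?_⟩
        · simp [hk, hx]
        · simp [hk, expLaw_univ (h.rate_pos _)]
      · refine ⟨r, fun x _ => ?_, ?_⟩
        · simp [← hk]
        · rw [← hk, ← expLaw_Ioi (h.rate_pos _)]
    choose r hr1 hr2 using hex
    have hms : MeasurableSet (Set.univ.pi s) := MeasurableSet.univ_pi fun k => by
      rcases hs k with hk | ⟨r, hk⟩
      · exact hk ▸ MeasurableSet.univ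
      · exact hk ▸ measurableSet_Ioi
    rw [hν, Measure.map_apply hSm hms, Measure.restrict_apply (hSm hms)]
    simp only [hr2]
    rw [← h.law n y r]
    refine measure_congr ?_
    filter_upwards [h.ae_hold_pos] with ω hω
    refine propext ?_
    change (_ ∧ _) ↔ _
    simp only [Set.mem_preimage, Set.mem_univ_pi, Set.mem_ofPred_eq]
    constructor
    · rintro ⟨h1, h2⟩ k
      exact ⟨h2 k, (hr1 k _ (hω k)).1 (h1 k)⟩
    · intro h1
      exact ⟨fun k => (hr1 k _ (hω k)).2 (h1 k).2, fun k => (h1 k).1⟩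
  have huniv : ν Set.univ = pathWeight J j y := by
    rw [← Set.pi_univ Set.univ, hbox _ fun k => Or.inl rfl]
    simp
  by_cases hw : pathWeight J j y = 0
  · rw [hw, zero_smul]
    rwa [hw, Measure.measure_univ_eq_zero] at huniv
  · have hw' := pathWeight_ne_top J h.stochastic j y
    have hpi : Measure.pi (fun k => expLaw (q (y k))) = (pathWeight J j y)⁻¹ • ν := by
      refine Measure.pi_eq_generateFrom (C := fun _ => halfLines)
        (fun _ => generateFrom_halfLines) (fun _ => isPiSystem_halfLines)
        (fun k => ⟨fun _ => Set.univ, fun _ => Or.inl rfl, fun _ => by simp, ?_⟩) ?_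
      · simp [Set.iUnion_const]
      · intro s hs
        rw [Measure.smul_apply, hbox s hs, smul_eq_mul, ← mul_assoc,
          ENNReal.inv_mul_cancel hw hw', one_mul]
    rw [hpi, smul_smul, ENNReal.mul_inv_cancel hw hw', one_smul]

lemma lintegral_path [Countable E] [IsProbabilityMeasure P] (h : IsJumpHold q J j P Y S)
    {n : ℕ} (y : Fin (n + 1) → E) (G : Fin (n + 1) → ℝ≥0∞ → ℝ≥0∞) (hG : ∀ k, Measurable (G k)) :
    ∫⁻ ω, {ω | ∀ k : Fin (n + 1), Y k ω = y k}.indicator (fun ω => ∏ k, G k (S k ω)) ω ∂P =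
      pathWeight J j y * ∏ k, ∫⁻ s, G k s ∂expLaw (q (y k)) := by
  have hpr : ∀ k, IsProbabilityMeasure (expLaw (q (y k))) := fun k =>
    isProbabilityMeasure_expLaw (h.rate_pos _)
  have hSm : Measurable (fun ω (k : Fin (n + 1)) => S k ω) :=
    measurable_pi_lambda _ fun k => h.measurable_hold k
  rw [lintegral_indicator (h.measurableSet_path y),
    ← lintegral_map (f := fun s : Fin (n + 1) → ℝ≥0∞ => ∏ k, G k (s k)) (by fun_prop) hSm,
    h.map_hold y, lintegral_smul_measure, smul_eq_mul]
  congr 1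
  rw [ProbabilityTheory.lintegral_prod_eq_prod_lintegral_of_indepFun Finset.univ
    (fun k (s : Fin (n + 1) → ℝ≥0∞) => G k (s k))
    (ProbabilityTheory.iIndepFun_pi fun k => (hG k).aemeasurable) (fun k => by fun_prop)]
  refine Finset.prod_congr rfl fun k _ => ?_
  exact (measurePreserving_eval (fun k => expLaw (q (y k))) k).lintegral_comp (hG k)

lemma ae_path [Countable E] [IsProbabilityMeasure P] (h : IsJumpHold q J j P Y S) (n : ℕ) :
    ∀ᵐ ω ∂P, pathWeight J j (fun k : Fin (n + 1) => Y k ω) ≠ 0 := by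
  have hsub : {ω | ¬ pathWeight J j (fun k : Fin (n + 1) => Y k ω) ≠ 0} ⊆
      ⋃ y : {y : Fin (n + 1) → E // pathWeight J j y = 0},
        {ω | ∀ k : Fin (n + 1), Y k ω = y.1 k} := by
    intro ω hω
    exact Set.mem_iUnion.2 ⟨⟨_, not_not.1 hω⟩, fun k => rfl⟩
  refine measure_mono_null hsub (measure_iUnion_null fun y => ?_)
  have h1 := h.lintegral_path y.1 (fun _ _ => 1) fun _ => measurable_const
  rw [y.2, zero_mul, lintegral_indicator (h.measurableSet_path y.1)] at h1
  simpa using h1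

lemma ae_jump_ne [Countable E] [IsProbabilityMeasure P] (h : IsJumpHold q J j P Y S)
    (hJ : ∀ i, J i i = 0) : ∀ᵐ ω ∂P, ∀ n, Y (n + 1) ω ≠ Y n ω := by
  rw [ae_all_iff]
  intro n
  filter_upwards [h.ae_path (n + 1)] with ω hω heq
  refine hω (mul_eq_zero_of_right _ (Finset.prod_eq_zero (Finset.mem_univ (Fin.last n)) ?_))
  simp [heq, hJ]

lemma ae_hold_lt_top [Countable E] [IsProbabilityMeasure P] (h : IsJumpHold q J j P Y S) :
    ∀ᵐ ω ∂P, ∀ n, S n ω < ∞ := by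
  rw [ae_all_iff]
  intro n
  have hsub : {ω | ¬ S n ω < ∞} ⊆ ⋃ y : Fin (n + 1) → E,
      {ω | ∀ k : Fin (n + 1), Y k ω = y k} ∩ {ω | S n ω = ∞} := by
    intro ω hω
    exact Set.mem_iUnion.2 ⟨fun k => Y k ω, fun k => rfl, not_lt_top_iff.1 hω⟩
  refine measure_mono_null hsub (measure_iUnion_null fun y => ?_)
  have hpr : ∀ k, IsProbabilityMeasure (expLaw (q (y k))) := fun k =>
    isProbabilityMeasure_expLaw (h.rate_pos _)
  have hSm : Measurable (fun ω (k : Fin (n + 1)) => S k ω) :=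
    measurable_pi_lambda _ fun k => h.measurable_hold k
  have hB : MeasurableSet ((fun s : Fin (n + 1) → ℝ≥0∞ => s (Fin.last n)) ⁻¹' {∞}) :=
    measurable_pi_apply _ (measurableSet_singleton _)
  have h1 := congrArg (fun ν => ν ((fun s : Fin (n + 1) → ℝ≥0∞ => s (Fin.last n)) ⁻¹' {∞}))
    (h.map_hold y)
  rw [Measure.map_apply hSm hB, Measure.restrict_apply (hSm hB), Measure.smul_apply,
    (measurePreserving_eval (fun k => expLaw (q (y k))) (Fin.last n)).measure_preimage
      (measurableSet_singleton _).nullMeasurableSet, expLaw_singleton_top, smul_zero,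
    Set.inter_comm] at h1
  exact h1

end IsJumpHold

end JumpHold

section ExcursionTerm

variable {E Ω : Type*} [DecidableEq E] [MeasurableSpace Ω]

open Classical in
/-- The part of the weighted occupation time of `i` before the return to `j` that is due to the
`n`-th holding time, where the state `k` is weighted with the exponential rate `a k`. -/
noncomputable def excursionTerm (a : E → ℝ) (j i : E) (Y : ℕ → Ω → E) (S : ℕ → Ω → ℝ≥0∞)
    (n : ℕ) (ω : Ω) : ℝ≥0∞ :=
  if Y n ω = i ∧ ∀ m, m ≠ 0 → m ≤ n → Y m ω ≠ j then
    (∏ k ∈ Finset.range n, expWeight (a (Y k ω)) (S k ω)) * expOccupation (a i) (S n ω)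
  else 0

namespace IsJumpHold

variable {q : E → ℝ} {J : E → E → ℝ≥0∞} {j : E} {P : Measure Ω}
  {Y : ℕ → Ω → E} {S : ℕ → Ω → ℝ≥0∞}

omit [MeasurableSpace Ω] in
open Classical in
lemma excursionTerm_eq_tsum (a : E → ℝ) (j i : E) (n : ℕ) (ω : Ω) :
    excursionTerm a j i Y S n ω = ∑' y : Fin (n + 1) → E,
      {ω | ∀ k : Fin (n + 1), Y k ω = y k}.indicator (fun ω => ∏ k : Fin (n + 1),
        (if k = Fin.last n then expOccupation (a (y k)) else expWeight (a (y k))) (S k ω)) ω *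
        (if y (Fin.last n) = i ∧ ∀ k, k ≠ 0 → y k ≠ j then 1 else 0) := by
  have hiff : (∀ k : Fin (n + 1), k ≠ 0 → Y k ω ≠ j) ↔ ∀ m, m ≠ 0 → m ≤ n → Y m ω ≠ j := by
    constructor
    · intro h m h0 hm
      exact h ⟨m, Nat.lt_succ_of_le hm⟩ (fun h => h0 (by simpa [Fin.ext_iff] using h))
    · intro h k h0
      exact h k (fun h => h0 (Fin.ext h)) (Nat.lt_succ_iff.1 k.2)
  rw [tsum_eq_single fun k : Fin (n + 1) => Y k ω]
  · rw [Set.indicator_of_mem (show ω ∈ {ω' | ∀ k : Fin (n + 1), Y k ω' = Y k ω} from fun _ => rfl)]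
    simp only [hiff, Fin.val_last, excursionTerm]
    split_ifs with h
    · rw [mul_one, Fin.prod_univ_castSucc, if_pos rfl,
        ← Fin.prod_univ_eq_prod_range (fun k => expWeight (a (Y k ω)) (S k ω))]
      simp only [Fin.castSucc_ne_last, if_false, Fin.val_castSucc, Fin.val_last, h.1]
    · rw [mul_zero]
  · intro y hy
    rw [Set.indicator_of_notMem fun h => hy (funext fun k => (h k).symm), zero_mul]

lemma measurable_excursionTerm_summand (h : IsJumpHold q J j P Y S) (a : E → ℝ) {n : ℕ}
    (y : Fin (n + 1) → E) :
    Measurable ({ω | ∀ k : Fin (n + 1), Y k ω = y k}.indicator (fun ω => ∏ k : Fin (n + 1),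
      (if k = Fin.last n then expOccupation (a (y k)) else expWeight (a (y k))) (S k ω))) := by
  refine Measurable.indicator (Finset.measurable_prod _ fun k _ => ?_) (h.measurableSet_path y)
  split_ifs
  · exact (measurable_expOccupation _).comp (h.measurable_hold k)
  · exact (measurable_expWeight _).comp (h.measurable_hold k)

lemma measurable_excursionTerm [Countable E] (h : IsJumpHold q J j P Y S) (a : E → ℝ) (i : E)
    (n : ℕ) : Measurable (excursionTerm a j i Y S n) := by
  classical
  have : excursionTerm a j i Y S n = fun ω => _ := funext (excursionTerm_eq_tsum a j i n)
  rw [this]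
  exact Measurable.tsum fun y =>
    (h.measurable_excursionTerm_summand a y).mul_const _

lemma lintegral_excursionTerm [Countable E] [IsProbabilityMeasure P] (h : IsJumpHold q J j P Y S)
    {a : E → ℝ} (ha : ∀ k, a k < q k) (i : E) (n : ℕ) :
    ∫⁻ ω, excursionTerm a j i Y S n ω ∂P =
      taboo (fun x z => J x z * ENNReal.ofReal (q x / (q x - a x))) j n i *
        ENNReal.ofReal (1 / (q i - a i)) := by
  classical
  simp only [excursionTerm_eq_tsum]
  rw [lintegral_tsum fun y =>
    ((h.measurable_excursionTerm_summand a y).mul_const _).aemeasurable,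
    ← tsum_pathWeight_taboo, ← ENNReal.tsum_mul_right]
  refine tsum_congr fun y => ?_
  rw [lintegral_mul_const _ (h.measurable_excursionTerm_summand a y), h.lintegral_path y]
  · by_cases hc : y (Fin.last n) = i ∧ ∀ k, k ≠ 0 → y k ≠ j
    · rw [if_pos hc, if_pos hc, mul_one, Fin.prod_univ_castSucc, if_pos rfl,
        lintegral_expOccupation (h.rate_pos _) (ha _), hc.1, ← mul_assoc]
      congr 1
      simp only [Fin.castSucc_ne_last, if_false, lintegral_expWeight (h.rate_pos _) (ha _),
        pathWeight, Finset.prod_mul_distrib, mul_assoc]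
    · rw [if_neg hc, if_neg hc, mul_zero, zero_mul]
  · intro k
    split_ifs
    · exact measurable_expOccupation _
    · exact measurable_expWeight _

lemma lintegral_tsum_excursionTerm [Countable E] [IsProbabilityMeasure P]
    (h : IsJumpHold q J j P Y S) {a : E → ℝ} (ha : ∀ k, a k < q k) (i : E) :
    ∫⁻ ω, ∑' n, excursionTerm a j i Y S n ω ∂P =
      tabooSum (fun x z => J x z * ENNReal.ofReal (q x / (q x - a x))) j i *
        ENNReal.ofReal (1 / (q i - a i)) := by
  rw [lintegral_tsum fun n => (h.measurable_excursionTerm a i n).aemeasurable, tabooSum,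
    ← ENNReal.tsum_mul_right]
  exact tsum_congr fun n => h.lintegral_excursionTerm ha i n

end IsJumpHold

end ExcursionTerm

section JumpPath

lemma intervalIntegral_eq_of_const_on_Ico {f : ℝ → ℝ} {a b c : ℝ} (hab : a ≤ b)
    (h : ∀ t ∈ Set.Ico a b, f t = c) :
    IntervalIntegrable f volume a b ∧ ∫ t in a..b, f t = c * (b - a) := by
  have hae : f =ᵐ[volume.restrict (Set.Ioc a b)] fun _ => c := by
    rw [Measure.restrict_congr_set Ioo_ae_eq_Ioc.symm]
    exact (ae_restrict_mem measurableSet_Ioo).mono fun t ht => h t ⟨ht.1.le, ht.2⟩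
  constructor
  · rw [intervalIntegrable_iff_integrableOn_Ioc_of_le hab]
    exact (integrable_const c).congr hae.symm
  · rw [intervalIntegral.integral_of_le hab, integral_congr_ae hae,
      ← intervalIntegral.integral_of_le hab, intervalIntegral.integral_const, smul_eq_mul, mul_comm]

variable {E : Type*}

/-- `x` is the path which occupies the state `y n` during the `n`-th of the successive
holding times `s 0, s 1, …`, all of which are positive and finite. -/
structure IsJumpPath (y : ℕ → E) (s : ℕ → ℝ≥0∞) (x : ℝ → Option E) : Prop where
  pos : ∀ n, 0 < s n
  lt_top : ∀ n, s n < ∞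
  ne : ∀ n, y (n + 1) ≠ y n
  eq_some_iff : ∀ t : ℝ, 0 ≤ t → ∀ i : E, x t = some i ↔
    ∃ n, (∑ k ∈ Finset.range n, s k) ≤ ENNReal.ofReal t ∧
      ENNReal.ofReal t < (∑ k ∈ Finset.range (n + 1), s k) ∧ y n = i

/-- The time of the `n`-th jump for given holding times. -/
noncomputable def jumpTime (s : ℕ → ℝ≥0∞) (n : ℕ) : ℝ := ∑ k ∈ Finset.range n, (s k).toReal

namespace IsJumpPath

variable {y : ℕ → E} {s : ℕ → ℝ≥0∞} {x : ℝ → Option E}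

lemma toReal_pos (h : IsJumpPath y s x) (n : ℕ) : 0 < (s n).toReal :=
  ENNReal.toReal_pos (h.pos n).ne' (h.lt_top n).ne

lemma jumpTime_succ (s : ℕ → ℝ≥0∞) (n : ℕ) :
    jumpTime s (n + 1) = jumpTime s n + (s n).toReal := Finset.sum_range_succ _ _

lemma jumpTime_zero (s : ℕ → ℝ≥0∞) : jumpTime s 0 = 0 := Finset.sum_range_zero _

lemma strictMono_jumpTime (h : IsJumpPath y s x) : StrictMono (jumpTime s) :=
  strictMono_nat_of_lt_succ fun n => by
    rw [jumpTime_succ]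
    linarith [h.toReal_pos n]

lemma jumpTime_nonneg (s : ℕ → ℝ≥0∞) (n : ℕ) : 0 ≤ jumpTime s n :=
  Finset.sum_nonneg fun _ _ => ENNReal.toReal_nonneg

lemma sum_eq_ofReal (h : IsJumpPath y s x) (n : ℕ) :
    ∑ k ∈ Finset.range n, s k = ENNReal.ofReal (jumpTime s n) := by
  rw [jumpTime, ENNReal.ofReal_sum_of_nonneg fun _ _ => ENNReal.toReal_nonneg]
  exact Finset.sum_congr rfl fun k _ => (ENNReal.ofReal_toReal (h.lt_top k).ne).symm

lemma eq_some_iff' (h : IsJumpPath y s x) {t : ℝ} (ht : 0 ≤ t) (i : E) :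
    x t = some i ↔ ∃ n, t ∈ Set.Ico (jumpTime s n) (jumpTime s (n + 1)) ∧ y n = i := by
  rw [h.eq_some_iff t ht i]
  simp only [h.sum_eq_ofReal, ENNReal.ofReal_le_ofReal_iff ht,
    ENNReal.ofReal_lt_ofReal_iff_of_nonneg ht, Set.mem_Ico, and_assoc]

lemma eq_of_mem (h : IsJumpPath y s x) {n : ℕ} {t : ℝ}
    (ht : t ∈ Set.Ico (jumpTime s n) (jumpTime s (n + 1))) : x t = some (y n) :=
  (h.eq_some_iff' ((jumpTime_nonneg s n).trans ht.1) _).2 ⟨n, ht, rfl⟩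

lemma jumpTime_mem (h : IsJumpPath y s x) (n : ℕ) :
    jumpTime s n ∈ Set.Ico (jumpTime s n) (jumpTime s (n + 1)) :=
  ⟨le_rfl, h.strictMono_jumpTime n.lt_succ_self⟩

lemma index_unique (h : IsJumpPath y s x) {m n : ℕ} {t : ℝ}
    (hm : t ∈ Set.Ico (jumpTime s m) (jumpTime s (m + 1)))
    (hn : t ∈ Set.Ico (jumpTime s n) (jumpTime s (n + 1))) : m = n := by
  have h1 := h.strictMono_jumpTime.lt_iff_lt.1 (hm.1.trans_lt hn.2)
  have h2 := h.strictMono_jumpTime.lt_iff_lt.1 (hn.1.trans_lt hm.2)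
  omega

lemma firstJump_eq (h : IsJumpPath y s x) : firstJump x = ENNReal.ofReal (jumpTime s 1) := by
  have h0 : x 0 = some (y 0) := by
    have := h.eq_of_mem (h.jumpTime_mem 0)
    rwa [jumpTime_zero] at this
  apply le_antisymm
  · refine sInf_le ⟨jumpTime s 1, ⟨?_, ?_⟩, rfl⟩
    · rw [← jumpTime_zero s]
      exact h.strictMono_jumpTime zero_lt_one
    · rw [h0, h.eq_of_mem (h.jumpTime_mem 1)]
      exact fun h1 => h.ne 0 (Option.some.inj h1)
  · refine le_sInf ?_
    rintro _ ⟨t, ⟨ht, hx⟩, rfl⟩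
    refine ENNReal.ofReal_le_ofReal ?_
    by_contra! hlt
    exact hx ((h.eq_of_mem (n := 0) ⟨by rw [jumpTime_zero]; exact ht.le, hlt⟩).trans h0.symm)

lemma lt_returnTime_iff (h : IsJumpPath y s x) (j : E) {n : ℕ} {t : ℝ}
    (ht : t ∈ Set.Ico (jumpTime s n) (jumpTime s (n + 1))) :
    ENNReal.ofReal t < returnTime j x ↔ ∀ m, m ≠ 0 → m ≤ n → y m ≠ j := by
  have ht0 : 0 ≤ t := (jumpTime_nonneg s n).trans ht.1
  constructor
  · intro hlt m hm hmn hy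
    refine absurd hlt (not_lt.2 ?_)
    refine le_trans (sInf_le ⟨jumpTime s m, ⟨jumpTime_nonneg s m, ?_, ?_⟩, rfl⟩)
      (ENNReal.ofReal_le_ofReal ((h.strictMono_jumpTime.monotone hmn).trans ht.1))
    · rw [h.firstJump_eq]
      exact ENNReal.ofReal_le_ofReal
        (h.strictMono_jumpTime.monotone (Nat.one_le_iff_ne_zero.2 hm))
    · rw [h.eq_of_mem (h.jumpTime_mem m), hy]
  · intro hn
    refine lt_of_lt_of_le ((ENNReal.ofReal_lt_ofReal_iff_of_nonneg ht0).2 ht.2) (le_sInf ?_)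
    rintro _ ⟨r, ⟨hr0, hr1, hr2⟩, rfl⟩
    rw [h.firstJump_eq, ENNReal.ofReal_le_ofReal_iff hr0] at hr1
    obtain ⟨m, hm, hmj⟩ := (h.eq_some_iff' hr0 j).1 hr2
    have hm1 := h.strictMono_jumpTime.lt_iff_lt.1 (hr1.trans_lt hm.2)
    refine ENNReal.ofReal_le_ofReal (le_trans (h.strictMono_jumpTime.monotone ?_) hm.1)
    by_contra! hlt
    exact hn m (by omega) (by omega) hmj

lemma integral_extend (h : IsJumpPath y s x) (d : E → ℝ) {n : ℕ} {t : ℝ}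
    (ht : t ∈ Set.Ico (jumpTime s n) (jumpTime s (n + 1))) :
    ∫ r in (0 : ℝ)..t, extend d (x r) =
      ∑ k ∈ Finset.range n, d (y k) * (s k).toReal + d (y n) * (t - jumpTime s n) := by
  have hpiece : ∀ m, ∀ r ∈ Set.Ico (jumpTime s m) (jumpTime s (m + 1)),
      extend d (x r) = d (y m) := fun m r hr => by rw [h.eq_of_mem hr, extend]
  have hsum : ∀ m, IntervalIntegrable (fun r => extend d (x r)) volume 0 (jumpTime s m) ∧
      ∫ r in (0 : ℝ)..jumpTime s m, extend d (x r) =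
        ∑ k ∈ Finset.range m, d (y k) * (s k).toReal := by
    intro m
    induction m with
    | zero => simp [jumpTime_zero]
    | succ m ih =>
      have h1 := intervalIntegral_eq_of_const_on_Ico
        (h.strictMono_jumpTime.monotone m.le_succ) (hpiece m)
      refine ⟨ih.1.trans h1.1, ?_⟩
      rw [← intervalIntegral.integral_add_adjacent_intervals ih.1 h1.1, ih.2, h1.2,
        Finset.sum_range_succ, jumpTime_succ, add_sub_cancel_left]
  have h1 := intervalIntegral_eq_of_const_on_Ico ht.1
    fun r hr => hpiece n r ⟨hr.1, hr.2.trans ht.2⟩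
  rw [← intervalIntegral.integral_add_adjacent_intervals (hsum n).1 h1.1, (hsum n).2, h1.2]

lemma setLIntegral_Ioi_eq (f : ℝ → ℝ≥0∞) :
    ∫⁻ t in Set.Ioi (0 : ℝ), f t = ∫⁻ t, (Set.Ici (0 : ℝ)).indicator f t := by
  rw [lintegral_indicator measurableSet_Ici, Measure.restrict_congr_set Ioi_ae_eq_Ici]

lemma expOccupation_eq (a : ℝ) {r : ℝ≥0∞} (hr : r ≠ ∞) :
    expOccupation a r = ∫⁻ t, (Set.Ico 0 r.toReal).indicator
      (fun t => ENNReal.ofReal (Real.exp (a * t))) t := by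
  rw [expOccupation, setLIntegral_Ioi_eq]
  congr 1
  ext t
  by_cases ht : 0 ≤ t
  · simp [Set.indicator, ht, ENNReal.ofReal_lt_iff_lt_toReal ht hr]
  · simp [Set.indicator, ht]

open Classical in
/-- The weighted occupation time of `i` before the return to `j` along a single path. -/
lemma lintegral_occupation (h : IsJumpPath y s x) (d : E → ℝ) (lam : ℝ) (j i : E) :
    ∫⁻ t in Set.Ioi (0 : ℝ), (if x t = some i ∧ ENNReal.ofReal t < returnTime j x then
      ENNReal.ofReal (Real.exp (-lam * t + ∫ r in (0 : ℝ)..t, extend d (x r))) else 0) =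
    ∑' n, if y n = i ∧ ∀ m, m ≠ 0 → m ≤ n → y m ≠ j then
      (∏ k ∈ Finset.range n, expWeight (d (y k) - lam) (s k)) *
        expOccupation (d i - lam) (s n) else 0 := by
  set C : ℕ → Prop := fun n => y n = i ∧ ∀ m, m ≠ 0 → m ≤ n → y m ≠ j with hC
  set W : ℕ → ℝ≥0∞ := fun n => ∏ k ∈ Finset.range n, expWeight (d (y k) - lam) (s k) with hW
  set g : ℕ → ℝ → ℝ≥0∞ := fun n => (Set.Ico 0 (s n).toReal).indicator
    (fun t => ENNReal.ofReal (Real.exp ((d i - lam) * t))) with hg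
  have hgm : ∀ n, Measurable (g n) := fun n =>
    Measurable.indicator (by fun_prop) measurableSet_Ico
  have hshift : ∀ n t, t - jumpTime s n ∈ Set.Ico 0 (s n).toReal ↔
      t ∈ Set.Ico (jumpTime s n) (jumpTime s (n + 1)) := fun n t => by
    rw [Set.mem_Ico, Set.mem_Ico, jumpTime_succ, sub_nonneg, sub_lt_iff_lt_add']
  have hterm : ∀ n t, t ∈ Set.Ico (jumpTime s n) (jumpTime s (n + 1)) →
      (if x t = some i ∧ ENNReal.ofReal t < returnTime j x then
        ENNReal.ofReal (Real.exp (-lam * t + ∫ r in (0 : ℝ)..t, extend d (x r))) else 0) =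
      (if C n then W n else 0) * g n (t - jumpTime s n) := by
    intro n t ht
    have hiff : (x t = some i ∧ ENNReal.ofReal t < returnTime j x) ↔ C n := by
      rw [h.lt_returnTime_iff j ht, h.eq_of_mem ht, Option.some_inj]
    by_cases hc : C n
    · rw [if_pos (hiff.2 hc), if_pos hc, hg]
      simp only
      rw [Set.indicator_of_mem ((hshift n t).2 ht), h.integral_extend d ht, hc.1, hW]
      simp only [expWeight]
      rw [← ENNReal.ofReal_prod_of_nonneg fun _ _ => (Real.exp_pos _).le, ← Real.exp_sum,
        ← ENNReal.ofReal_mul (Real.exp_pos _).le, ← Real.exp_add]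
      congr 2
      simp only [sub_mul, Finset.sum_sub_distrib, ← Finset.mul_sum]
      rw [← jumpTime]
      ring
    · rw [if_neg (mt hiff.1 hc), if_neg hc, zero_mul]
  have hall : ∀ t, (Set.Ici (0 : ℝ)).indicator (fun t =>
      if x t = some i ∧ ENNReal.ofReal t < returnTime j x then
        ENNReal.ofReal (Real.exp (-lam * t + ∫ r in (0 : ℝ)..t, extend d (x r))) else 0) t =
      ∑' n, (if C n then W n else 0) * g n (t - jumpTime s n) := by
    intro t
    by_cases hex : ∃ n, t ∈ Set.Ico (jumpTime s n) (jumpTime s (n + 1))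
    · obtain ⟨n, hn⟩ := hex
      rw [Set.indicator_of_mem (Set.mem_Ici.2 ((jumpTime_nonneg s n).trans hn.1)), hterm n t hn,
        tsum_eq_single n]
      intro m hm
      rw [hg]
      simp only
      rw [Set.indicator_of_notMem fun h1 => hm (h.index_unique ((hshift m t).1 h1) hn), mul_zero]
    · have h0 : ∀ n, g n (t - jumpTime s n) = 0 := fun n =>
        Set.indicator_of_notMem (fun h1 => hex ⟨n, (hshift n t).1 h1⟩) _
      simp only [h0, mul_zero, tsum_zero]
      refine Set.indicator_apply_eq_zero.2 fun ht => if_neg fun hx => ?_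
      obtain ⟨n, hn, -⟩ := (h.eq_some_iff' ht i).1 hx.1
      exact hex ⟨n, hn⟩
  rw [setLIntegral_Ioi_eq, lintegral_congr hall, lintegral_tsum fun n => by fun_prop]
  refine tsum_congr fun n => ?_
  rw [lintegral_const_mul _ (by fun_prop), lintegral_sub_right_eq_self (g n),
    ← expOccupation_eq _ (h.lt_top n).ne, ite_mul, zero_mul]

end IsJumpPath

end JumpPath

section HoldingRates

variable {E : Type*} [DecidableEq E]

/-- The jump rates `q_i = d_i - m_{ii}`. -/
noncomputable def rate (M : Matrix E E ℝ) (i : E) : ℝ := rowSum M i - M i i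

lemma qMatrix_self (M : Matrix E E ℝ) (i : E) : qMatrix M i i = -rate M i := by
  simp [qMatrix, rate]

lemma hasSum_offDiag {M : Matrix E E ℝ} {i : E} (hrow : Summable fun k => M i k) :
    HasSum (fun k => if k = i then 0 else M i k) (rate M i) := by
  have h := hrow.hasSum.sub (hasSum_ite_eq i (M i i))
  convert! h using 2 with k
  split_ifs with hk
  · simp [hk]
  · simp

lemma rate_pos {M : Matrix E E ℝ} (hM : IsMetzler M) {i : E} (hrow : Summable fun k => M i k)
    (hex : ∃ k, k ≠ i ∧ 0 < M i k) : 0 < rate M i := by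
  obtain ⟨k, hk, hpos⟩ := hex
  have hsum := hasSum_offDiag hrow
  rw [← hsum.tsum_eq]
  refine hsum.summable.tsum_pos (fun k => ?_) k ?_
  · split_ifs with h
    · exact le_rfl
    · exact hM i k (Ne.symm h)
  · simpa [hk] using hpos

lemma jumpMatrix_qMatrix {M : Matrix E E ℝ} {i : E} (hq : 0 < rate M i) (k : E) :
    jumpMatrix (qMatrix M) i k = (if k = i then 0 else M i k) / rate M i := by
  rw [jumpMatrix, qMatrix_self, if_neg (neg_ne_zero.2 hq.ne'), neg_neg]
  by_cases h : i = k
  · simp [h]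
  · simp [h, Ne.symm h, qMatrix]

lemma jumpMatrix_nonneg {M : Matrix E E ℝ} (hM : IsMetzler M) {i : E} (hq : 0 < rate M i)
    (k : E) : 0 ≤ jumpMatrix (qMatrix M) i k := by
  rw [jumpMatrix_qMatrix hq]
  refine div_nonneg ?_ hq.le
  split_ifs with h
  · exact le_rfl
  · exact hM i k (Ne.symm h)

lemma tsum_jumpMatrix {M : Matrix E E ℝ} (hM : IsMetzler M) {i : E}
    (hrow : Summable fun k => M i k) (hq : 0 < rate M i) :
    ∑' k, ENNReal.ofReal (jumpMatrix (qMatrix M) i k) = 1 := by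
  have h := (hasSum_offDiag hrow).div_const (rate M i)
  simp only [← jumpMatrix_qMatrix hq, div_self hq.ne'] at h
  rw [← ENNReal.ofReal_tsum_of_nonneg (jumpMatrix_nonneg hM hq) h.summable, h.tsum_eq,
    ENNReal.ofReal_one]

lemma isJumpHold_of_law {Ω : Type*} [MeasurableSpace Ω] {P : Measure Ω} {M : Matrix E E ℝ}
    (hM : IsMetzler M) (hrow : ∀ i, Summable fun k => M i k) (hq : ∀ i, 0 < rate M i) {j : E}
    {Y : ℕ → Ω → E} {S : ℕ → Ω → ℝ≥0∞} (hY : ∀ n i, MeasurableSet {ω | Y n ω = i})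
    (hS : ∀ n, Measurable (S n))
    (hlaw : ∀ (n : ℕ) (y : ℕ → E) (s : ℕ → ℝ≥0),
      P {ω | ∀ k ≤ n, Y k ω = y k ∧ (s k : ℝ≥0∞) < S k ω} =
        ENNReal.ofReal ((if y 0 = j then 1 else 0) *
          (∏ k ∈ Finset.range n, jumpMatrix (qMatrix M) (y k) (y (k + 1))) *
          ∏ k ∈ Finset.range (n + 1), Real.exp (qMatrix M (y k) (y k) * s k))) :
    IsJumpHold (rate M) (fun i k => ENNReal.ofReal (jumpMatrix (qMatrix M) i k)) j P Y S where
  rate_pos := hq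
  stochastic i := tsum_jumpMatrix hM (hrow i) (hq i)
  measurableSet_jump := hY
  measurable_hold := hS
  law n y s := by
    have h := hlaw n (fun k => y (Fin.ofNat (n + 1) k)) (fun k => s (Fin.ofNat (n + 1) k))
    have hcast : ∀ k : Fin (n + 1), Fin.ofNat (n + 1) (k : ℕ) = k := fun k =>
      Fin.ext (Nat.mod_eq_of_lt k.2)
    have hset : {ω | ∀ k : Fin (n + 1), Y k ω = y k ∧ (s k : ℝ≥0∞) < S k ω} =
        {ω | ∀ k ≤ n, Y k ω = y (Fin.ofNat (n + 1) k) ∧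
          (s (Fin.ofNat (n + 1) k) : ℝ≥0∞) < S k ω} := by
      ext ω
      simp only [Set.mem_ofPred_eq]
      constructor
      · intro h k hk
        rw [show Fin.ofNat (n + 1) k = ⟨k, Nat.lt_succ_of_le hk⟩ from hcast ⟨k, _⟩]
        exact h ⟨k, Nat.lt_succ_of_le hk⟩
      · intro h k
        have := h k (Nat.lt_succ_iff.1 k.2)
        rwa [hcast] at this
    have hc1 : ∀ k : Fin n, Fin.ofNat (n + 1) (k : ℕ) = k.castSucc := fun k => hcast k.castSucc
    have hc2 : ∀ k : Fin n, Fin.ofNat (n + 1) ((k : ℕ) + 1) = k.succ := fun k => hcast k.succ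
    rw [hset, h, Finset.prod_range, Finset.prod_range]
    simp only [hcast, hc1, hc2, qMatrix_self]
    have h0 : (0 : ℝ) ≤ if y (Fin.ofNat (n + 1) 0) = j then 1 else 0 := by
      split_ifs <;> norm_num
    have hJ0 : ∀ i k, 0 ≤ jumpMatrix (qMatrix M) i k := fun i => jumpMatrix_nonneg hM (hq i)
    rw [ENNReal.ofReal_mul (mul_nonneg h0 (Finset.prod_nonneg fun k _ => hJ0 _ _)),
      ENNReal.ofReal_mul h0, ENNReal.ofReal_prod_of_nonneg fun k _ => hJ0 _ _,
      ENNReal.ofReal_prod_of_nonneg fun k _ => (Real.exp_pos _).le, pathWeight]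
    congr 2
    split_ifs with h1 h2 h2
    · simp
    · exact absurd h1 h2
    · exact absurd h2 h1
    · simp

lemma embeddedENN_eq {M : Matrix E E ℝ} (hM : IsMetzler M) {lam : ℝ} {i : E}
    (hq : 0 < rate M i) (k : E) :
    ENNReal.ofReal (jumpMatrix (qMatrix M) i k) *
      ENNReal.ofReal (rate M i / (rate M i - (rowSum M i - lam))) = embeddedENN M lam i k := by
  rw [← ENNReal.ofReal_mul (jumpMatrix_nonneg hM hq k), jumpMatrix_qMatrix hq,
    div_mul_div_cancel₀ hq.ne', embeddedENN, embedded]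
  have : rate M i - (rowSum M i - lam) = lam - M i i := by
    rw [rate]
    ring
  rw [this]
  by_cases h : i = k
  · simp [h]
  · simp [h, Ne.symm h]

lemma occupation_eq [Countable E] {Ω : Type*} [MeasurableSpace Ω] {P : Measure Ω}
    [IsProbabilityMeasure P] {M : Matrix E E ℝ} (hM : IsMetzler M)
    (hrow : ∀ i, Summable fun k => M i k) (hq : ∀ i, 0 < rate M i) {lam : ℝ}
    (hlam : ∀ i, M i i < lam) {j : E} {X : ℝ → Ω → Option E}
    (hX : IsMinimalQProcess (qMatrix M) j P X) (i : E) :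
    occupation (rowSum M) lam j P X i =
      tabooSum (embeddedENN M lam) j i * ENNReal.ofReal (1 / (lam - M i i)) := by
  obtain ⟨Y, S, hY, hS, hlaw, hpath⟩ := hX
  have h := isJumpHold_of_law hM hrow hq hY hS hlaw
  have hJ : ∀ i, ENNReal.ofReal (jumpMatrix (qMatrix M) i i) = 0 := fun i => by
    simp [jumpMatrix_qMatrix (hq i)]
  have hrate : ∀ i, rate M i - (rowSum M i - lam) = lam - M i i := fun i => by
    rw [rate]
    ring
  have hterm := h.lintegral_tsum_excursionTerm (a := fun i => rowSum M i - lam)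
    (fun i => by linarith [hlam i, hrate i]) i
  have hB : (fun x z => ENNReal.ofReal (jumpMatrix (qMatrix M) x z) *
      ENNReal.ofReal (rate M x / (rate M x - (rowSum M x - lam)))) = embeddedENN M lam :=
    funext₂ fun x z => embeddedENN_eq hM (hq x) z
  beta_reduce at hterm
  rw [hB, hrate] at hterm
  rw [← hterm, occupation]
  refine lintegral_congr_ae ?_
  filter_upwards [hpath, h.ae_hold_pos, h.ae_hold_lt_top, h.ae_jump_ne hJ] with ω h1 h2 h3 h4
  have h5 : IsJumpPath (fun n => Y n ω) (fun n => S n ω) fun t => X t ω := ⟨h2, h3, h4, h1⟩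
  simp only [excursionTerm]
  convert h5.lintegral_occupation (rowSum M) lam j i

end HoldingRates

/-- A left invariant vector of `embeddedENN M lam`, divided by `lam - m_{ii}`, is a left
eigenvector of `M`. -/
lemma hasSum_of_invariant {E : Type*} [DecidableEq E] {M : Matrix E E ℝ} (hM : IsMetzler M)
    {lam : ℝ} (hlam : ∀ i, M i i < lam) {v u : E → ℝ≥0∞} (hv : ∀ i, v i ≠ ∞)
    (hinv : ∀ i, ∑' k, v k * embeddedENN M lam k i = v i)
    (hu : ∀ i, u i = v i * ENNReal.ofReal (1 / (lam - M i i))) (i : E) :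
    HasSum (fun k => (u k).toReal * M k i) (lam * (u i).toReal) := by
  have hutr : ∀ k, (u k).toReal = (v k).toReal / (lam - M k k) := fun k => by
    have : 0 ≤ 1 / (lam - M k k) := one_div_nonneg.2 (sub_pos.2 (hlam k)).le
    rw [hu, ENNReal.toReal_mul, ENNReal.toReal_ofReal this, mul_one_div]
  have hfin : ∀ k, v k * embeddedENN M lam k i ≠ ∞ := fun k =>
    ENNReal.mul_ne_top (hv k) ENNReal.ofReal_ne_top
  have h1 : HasSum (fun k => (v k * embeddedENN M lam k i).toReal) (v i).toReal := by
    have h2 := hinv i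
    rw [← h2, ENNReal.tsum_toReal_eq hfin]
    exact (ENNReal.summable_toReal (h2 ▸ hv i)).hasSum
  have h3 := h1.add (hasSum_ite_eq i ((u i).toReal * M i i))
  convert! h3 using 1
  · ext k
    rw [ENNReal.toReal_mul, hutr, embeddedENN, embedded]
    split_ifs with h
    · subst h
      simp [hutr]
    · have h4 : 0 ≤ M k i / (lam - M k k) := div_nonneg (hM k i h) (sub_pos.2 (hlam k)).le
      rw [ENNReal.toReal_ofReal h4, add_zero]
      ring
  · have := (sub_pos.2 (hlam i)).ne'
    rw [hutr]
    field_simp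
    ring

end MetzlerRep

theorem theorem1p3 {E : Type*} [Countable E] [DecidableEq E]
    (M : Matrix E E ℝ)
    (hM : MetzlerRep.IsMetzler M) (hirr : MetzlerRep.IsIrreducible M)
    (hrow : ∀ i, Summable (fun k => M i k))
    (hdiag : BddAbove (Set.range fun i => M i i))
    (d : ℝ) (hd : ∀ i, 0 ≤ M i i + d)
    (hR : 0 < MetzlerRep.convParam (MetzlerRep.shift M d))
    (hrec : MetzlerRep.IsRecurrent fun i k =>
      ENNReal.ofReal (MetzlerRep.embedded M (MetzlerRep.eigval M d) i k))
    (j : E)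
    {Ω : Type*} [MeasurableSpace Ω] (P : MeasureTheory.Measure Ω)
    [MeasureTheory.IsProbabilityMeasure P]
    (X : ℝ → Ω → Option E)
    (hX : MetzlerRep.IsMinimalQProcess (MetzlerRep.qMatrix M) j P X)
    (u : E → ENNReal)
    (hu : ∀ i, u i =
      MetzlerRep.occupation (MetzlerRep.rowSum M) (MetzlerRep.eigval M d) j P X i) :
    (∀ i, 0 < u i ∧ u i < ⊤) ∧
      ∀ i, HasSum (fun k => (u k).toReal * M k i) (MetzlerRep.eigval M d * (u i).toReal) := by
  have hex := MetzlerRep.exists_pos_of_recurrent_embedded hM hrec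
  have hlam : ∀ i, M i i < MetzlerRep.eigval M d := fun i => (hex i).1
  have hq : ∀ i, 0 < MetzlerRep.rate M i := fun i => MetzlerRep.rate_pos hM (hrow i) (hex i).2
  have hone : MetzlerRep.returnWeight
      (MetzlerRep.embeddedENN M (MetzlerRep.eigval M d)) j = 1 :=
    le_antisymm (MetzlerRep.returnWeight_embedded_le_one hM hd hR hlam j)
      (MetzlerRep.one_le_returnWeight _ j (hrec j j))
  have hv := MetzlerRep.tabooSum_pos_and_lt_top hirr hlam hone
  have hu' : ∀ i, u i = _ := fun i =>
    (hu i).trans (MetzlerRep.occupation_eq hM hrow hq hlam hX i)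
  refine ⟨fun i => ?_, MetzlerRep.hasSum_of_invariant hM hlam (fun i => (hv i).2.ne)
    (MetzlerRep.tabooSum_invariant hone) hu'⟩
  rw [hu' i]
  have hpos : 0 < 1 / (MetzlerRep.eigval M d - M i i) := one_div_pos.2 (sub_pos.2 (hlam i))
  exact ⟨ENNReal.mul_pos (hv i).1.ne' (ENNReal.ofReal_pos.2 hpos).ne',
    ENNReal.mul_lt_top (hv i).2 ENNReal.ofReal_lt_top⟩
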